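/- Let $n,m\in\mathbb{N}$, $A\in\mathbb{R}^{n\times n}$, $B\in\mathbb{R}^{n\times m}$. A set in $\mathbb{R}^p$ is a *proper $C$-set* if it is compact, convex and contains the origin in its interior. For a set $\mathcal{X}\subseteq\mathbb{R}^p$ with $0\in\mathcal{X}$ let $\mathcal{X}^*=\{x:\ y^Tx\le 1\ \text{for all } y\in\mathcal{X}\}$ be its polar, and for a proper $C$-set $\mathcal{X}$ let $g_{\mathcal{X}}(y)=\min\{\eta\ge 0:\ y\in\eta\mathcal{X}\}$ be its Minkowski function. Let $\oplus$ be Minkowski addition, $P_x=(I\ O)\in\mathbb{R}^{n\times(n+m)}$ the projection $(x,u)\mapsto x$, and let convergence of nonempty compact convex sets be with respect to the Hausdorff distance. Suppose that $(A,B)$ is strictly stabilizable (the map induced by $A$ on the quotient of $\mathbb{R}^n$ by the controllable subspace $\sum_{k\ge0}\operatorname{range}(A^kB)$ has all its complex eigenvalues in the open unit disc), that $\mathcal{C}$ is a proper $C$-set in $\mathbb{R}^{n+m}$, and that $\mathcal{Q}_f$ is a proper $C$-set in $\mathbb{R}^n$. Let $\mathcal{L}\subseteq\mathcal{Q}_f$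 be a proper $C$-set in $\mathbb{R}^n$ such that for every $x\in\mathbb{R}^n$ there is a $u\in\mathbb{R}^m$ with $$g_{\mathcal{L}}(Ax+Bu)+g_{\mathcal{C}}((x,u))\le g_{\mathcal{L}}(x).$$ Given $\mathcal{P}_0$, define for all $k\ge 0$ $$\mathcal{T}_{k+1}=\left(\mathcal{C}^*\oplus(A\ B)^T\mathcal{P}_k^*\right)^*,\qquad \mathcal{P}_{k+1}=P_x\mathcal{T}_{k+1}.$$ Let $\mathcal{P}_k,\mathcal{T}_k$ be the sets obtained from $\mathcal{P}_0=\mathcal{Q}_f$ (arbitrary iterates), $\underline{\mathcal{P}}_k$ those obtained from $\underline{\mathcal{P}}_0=\mathbb{R}^n$, i.e. $\underline{\mathcal{P}}_0^*=\{0\}$ (lower iterates), and $\overline{\mathcal{P}}_k$ those obtained from $\overline{\mathcal{P}}_0=\mathcal{L}$ (upper iterates). Then: (i) The sequence $\{\mathcal{P}_k\}_{k\ge1}$ converges to a proper $C$-set $\mathcal{P}_\infty$ in $\mathbb{R}^n$. (ii) The sequences $\{\underline{\mathcal{P}}_k\}_{k\ge1}$ and $\{\overline{\mathcal{P}}_k\}_{k\ge1}$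 converge, and their limits $\underline{\mathcal{P}}_\infty$, $\overline{\mathcal{P}}_\infty$ satisfy $\overline{\mathcal{P}}_\infty=\mathcal{P}_\infty=\underline{\mathcal{P}}_\infty$. (iii) The sequence $\{\mathcal{T}_k\}_{k\ge1}$ converges to a proper $C$-set $\mathcal{T}_\infty$ in $\mathbb{R}^{n+m}$ with $$\mathcal{T}_\infty=\left(\mathcal{C}^*\oplus(A\ B)^T\mathcal{P}_\infty^*\right)^*\quad\text{and}\quad \mathcal{P}_\infty=P_x\mathcal{T}_\infty.$$ (iv) $\mathcal{P}_\infty$ solves the fixed point set equation $\mathcal{P}=P_x\left(\mathcal{C}^*\oplus(A\ B)^T\mathcal{P}^*\right)^*$. -/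

import Mathlib

open Filter Topology
open scoped Pointwise

noncomputable section

namespace MinkowskiBellman

/-- A `C`-set: compact, convex, containing the origin. -/
structure IsCSet {ι : Type*} [Fintype ι] (X : Set (EuclideanSpace ℝ ι)) : Prop where
  isCompact : IsCompact X
  convex : Convex ℝ X
  zero_mem : (0 : EuclideanSpace ℝ ι) ∈ X

/-- A proper `C`-set: a `C`-set containing the origin in its interior. -/
structure IsProperCSet {ι : Type*} [Fintype ι] (X : Set (EuclideanSpace ℝ ι)) : Prop
    extends IsCSet X where
  zero_mem_interior : (0 : EuclideanSpace ℝ ι) ∈ interior X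

/-- The (one-sided) polar set `X^* = {x | ∀ y ∈ X, yᵀ x ≤ 1}`. -/
def polar {ι : Type*} [Fintype ι] (X : Set (EuclideanSpace ℝ ι)) : Set (EuclideanSpace ℝ ι) :=
  {x | ∀ y ∈ X, inner ℝ y x ≤ 1}

/-- The image `M X = {M x | x ∈ X}` of a set under a matrix. -/
def matImage {ι κ : Type*} [Fintype ι] [Fintype κ] [DecidableEq κ] (M : Matrix ι κ ℝ)
    (X : Set (EuclideanSpace ℝ κ)) : Set (EuclideanSpace ℝ ι) :=
  (fun x => Matrix.toEuclideanLin M x) '' X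

/-- Convergence with respect to the Hausdorff distance of a sequence of nonempty compact convex
sets to a nonempty compact convex set. -/
structure HausdorffTendsto {ι : Type*} [Fintype ι] (S : ℕ → Set (EuclideanSpace ℝ ι))
    (L : Set (EuclideanSpace ℝ ι)) : Prop where
  terms : ∀ k, (S k).Nonempty ∧ IsCompact (S k) ∧ Convex ℝ (S k)
  limit : L.Nonempty ∧ IsCompact L ∧ Convex ℝ L
  tendsto : Tendsto (fun k => Metric.hausdorffDist (S k) L) atTop (𝓝 0)

variable {n m : ℕ}

/-- The vector `(x, u)` of `ℝ^{n+m}`. -/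
def pair (x : EuclideanSpace ℝ (Fin n)) (u : EuclideanSpace ℝ (Fin m)) :
    EuclideanSpace ℝ (Fin n ⊕ Fin m) :=
  WithLp.toLp 2 (Sum.elim (fun i => x i) (fun j => u j))

/-- The projection matrix `P_x = (I O)`. -/
def projX (n m : ℕ) : Matrix (Fin n) (Fin n ⊕ Fin m) ℝ := Matrix.fromCols 1 0

/-- The controllable subspace of `(A, B)`, the sum of the ranges of `A ^ k B`, `k ∈ ℕ`. -/
def controllableSubspace (A : Matrix (Fin n) (Fin n) ℝ) (B : Matrix (Fin n) (Fin m) ℝ) :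
    Submodule ℝ (Fin n → ℝ) :=
  ⨆ k : ℕ, LinearMap.range (Matrix.toLin' (A ^ k * B))

theorem controllableSubspace_le_comap (A : Matrix (Fin n) (Fin n) ℝ)
    (B : Matrix (Fin n) (Fin m) ℝ) :
    controllableSubspace A B ≤ (controllableSubspace A B).comap (Matrix.toLin' A) := by
  unfold controllableSubspace
  refine iSup_le fun k => ?_
  rintro _ ⟨v, rfl⟩
  refine Submodule.mem_comap.2 (Submodule.mem_iSup_of_mem (k + 1) ⟨v, ?_⟩)
  rw [← LinearMap.comp_apply, ← Matrix.toLin'_mul, ← Matrix.mul_assoc, pow_succ']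

/-- The uncontrollable part of the dynamics: the map induced by `A` on the quotient of the state
space by the controllable subspace. -/
def uncontrollablePart (A : Matrix (Fin n) (Fin n) ℝ) (B : Matrix (Fin n) (Fin m) ℝ) :
    ((Fin n → ℝ) ⧸ controllableSubspace A B) →ₗ[ℝ] ((Fin n → ℝ) ⧸ controllableSubspace A B) :=
  (controllableSubspace A B).mapQ (controllableSubspace A B) (Matrix.toLin' A)
    (controllableSubspace_le_comap A B)

/-- `(A, B)` is strictly stabilizable: the uncontrollable part of the dynamics is strictly stable,
i.e. all its complex eigenvalues lie in the open unit disc. -/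
def StrictlyStabilizable (A : Matrix (Fin n) (Fin n) ℝ) (B : Matrix (Fin n) (Fin m) ℝ) : Prop :=
  ∀ z : ℂ, ((uncontrollablePart A B).charpoly.map (algebraMap ℝ ℂ)).IsRoot z → ‖z‖ < 1

/-- The control Lyapunov decrease condition for the Minkowski function of `L`. -/
def ControlLyapunov (A : Matrix (Fin n) (Fin n) ℝ) (B : Matrix (Fin n) (Fin m) ℝ)
    (C : Set (EuclideanSpace ℝ (Fin n ⊕ Fin m))) (L : Set (EuclideanSpace ℝ (Fin n))) : Prop :=
  ∀ x : EuclideanSpace ℝ (Fin n), ∃ u : EuclideanSpace ℝ (Fin m),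
    gauge L (Matrix.toEuclideanLin A x + Matrix.toEuclideanLin B u) + gauge C (pair x u)
      ≤ gauge L x

/-- The set `(C^* ⊕ (A B)ᵀ P^*)^*` in `ℝ^{n+m}`. -/
def stepT (A : Matrix (Fin n) (Fin n) ℝ) (B : Matrix (Fin n) (Fin m) ℝ)
    (C : Set (EuclideanSpace ℝ (Fin n ⊕ Fin m))) (P : Set (EuclideanSpace ℝ (Fin n))) :
    Set (EuclideanSpace ℝ (Fin n ⊕ Fin m)) :=
  polar (polar C + matImage (Matrix.fromCols A B).transpose (polar P))

/-- The generator sets: `P_0` is given and `P_{k+1} = P_x (C^* ⊕ (A B)ᵀ P_k^*)^*`. -/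
def genP (A : Matrix (Fin n) (Fin n) ℝ) (B : Matrix (Fin n) (Fin m) ℝ)
    (C : Set (EuclideanSpace ℝ (Fin n ⊕ Fin m))) (P₀ : Set (EuclideanSpace ℝ (Fin n))) :
    ℕ → Set (EuclideanSpace ℝ (Fin n))
  | 0 => P₀
  | k + 1 => matImage (projX n m) (stepT A B C (genP A B C P₀ k))

/-- The set `{0}` is the polar of the whole space, so that the iterates with `P_0^* = {0}` are those
started at the whole space. -/
theorem polar_univ {ι : Type*} [Fintype ι] :
    polar (Set.univ : Set (EuclideanSpace ℝ ι)) = {0} := by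
  ext x
  simp only [polar, Set.mem_univ, forall_const, Set.mem_ofPred_eq, Set.mem_singleton_iff]
  constructor
  · intro h
    by_contra hx
    have hpos : 0 < inner ℝ x x := real_inner_self_pos.2 hx
    have h2 := h ((2 / inner ℝ x x) • x)
    rw [real_inner_smul_left, div_mul_cancel₀ _ hpos.ne'] at h2
    norm_num at h2
  · rintro rfl y
    simp

end MinkowskiBellman

end

open MinkowskiBellman

namespace MinkowskiBellman

/-! The map F = `stepP` is monotone. The Lyapunov inequality gives L ⊆ F(L), so the iterates from L
increase, while those from the whole space decrease; iterates from any set containing L lie between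
them. The gap is measured by dilation: P' ⊆ (1 + d)P. If L contains the ball of radius r and C lies
in the ball of radius R, `stepP_subset_smul_of_subset_smul` shows that one step shrinks d by the
factor 1 - r/R, because the stage cost consumes at least r/R of the polar budget 1 away from a small
ball. Hence d decays geometrically, and since all iterates after the first step lie in one ball, the
dilation gap bounds the Hausdorff distance (`hausdorffTendsto_of_sandwich`). The common limit is the
intersection of the lower iterates; monotonicity and closedness make it a fixed point. -/

theorem subset_smul_of_one_le {E : Type*} [AddCommGroup E] [Module ℝ E] {X : Set E}
    (hX : Convex ℝ X) (h0 : 0 ∈ X) {a : ℝ} (ha : 1 ≤ a) : X ⊆ a • X := by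
  intro x hx
  have ha0 : 0 < a := by linarith
  exact (Set.mem_smul_set_iff_inv_smul_mem₀ ha0.ne' _ _).2
    (hX.smul_mem_of_zero_mem h0 hx ⟨by positivity, inv_le_one_of_one_le₀ ha⟩)

/-! ### Polar sets and norm bounds -/

section Polar

variable {ι : Type*} [Fintype ι]

theorem polar_anti {X Y : Set (EuclideanSpace ℝ ι)} (h : X ⊆ Y) : polar Y ⊆ polar X :=
  fun _ hx y hy => hx y (h hy)

theorem zero_mem_polar (X : Set (EuclideanSpace ℝ ι)) : 0 ∈ polar X := fun y _ => by simp

theorem convex_polar (X : Set (EuclideanSpace ℝ ι)) : Convex ℝ (polar X) := by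
  intro x hx y hy a b ha hb hab z hz
  rw [inner_add_right, real_inner_smul_right, real_inner_smul_right]
  nlinarith [mul_le_mul_of_nonneg_left (hx z hz) ha, mul_le_mul_of_nonneg_left (hy z hz) hb]

theorem isClosed_polar (X : Set (EuclideanSpace ℝ ι)) : IsClosed (polar X) := by
  have : polar X = ⋂ y ∈ X, {x | inner ℝ y x ≤ 1} := by
    ext x; simp [polar]
  rw [this]
  exact isClosed_biInter fun y _ => isClosed_le (by fun_prop) continuous_const

/-- The polar of a set contained in the ball of radius `R` contains the ball of radius `1 / R`. -/
theorem mem_polar_of_norm_mul_le {X : Set (EuclideanSpace ℝ ι)} {R : ℝ}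
    (hX : ∀ y ∈ X, ‖y‖ ≤ R) {x : EuclideanSpace ℝ ι} (hx : R * ‖x‖ ≤ 1) : x ∈ polar X := by
  intro y hy
  calc inner ℝ y x ≤ ‖y‖ * ‖x‖ := real_inner_le_norm y x
    _ ≤ R * ‖x‖ := by gcongr; exact hX y hy
    _ ≤ 1 := hx

/-- The polar of a set containing the ball of radius `r` is contained in the ball of radius
`1 / r`. -/
theorem norm_le_of_mem_polar {X : Set (EuclideanSpace ℝ ι)} {r : ℝ} (hr : 0 < r)
    (hX : ∀ y, ‖y‖ ≤ r → y ∈ X) {x : EuclideanSpace ℝ ι} (hx : x ∈ polar X) : ‖x‖ ≤ 1 / r := by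
  rcases eq_or_ne x 0 with rfl | h0
  · simp [hr.le]
  have hn : 0 < ‖x‖ := norm_pos_iff.2 h0
  have h := hx ((r / ‖x‖) • x) (hX _ (by
    rw [norm_smul, Real.norm_of_nonneg (by positivity), div_mul_cancel₀ _ hn.ne']))
  rw [real_inner_smul_left, real_inner_self_eq_norm_sq] at h
  rw [le_div_iff₀ hr]
  calc ‖x‖ * r = r / ‖x‖ * ‖x‖ ^ 2 := by field_simp
    _ ≤ 1 := h

/-- The easy half of gauge–polar duality; it turns the Lyapunov inequality into membership in a
polar. -/
theorem inner_le_gauge {X : Set (EuclideanSpace ℝ ι)} (hX : X ∈ 𝓝 0)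
    {c : EuclideanSpace ℝ ι} (hc : c ∈ polar X) (z : EuclideanSpace ℝ ι) :
    inner ℝ c z ≤ gauge X z := by
  refine le_csInf (absorbent_nhds_zero hX).gauge_set_nonempty ?_
  rintro r ⟨hr, y, hy, rfl⟩
  change inner ℝ c (r • y) ≤ r
  rw [real_inner_smul_right, real_inner_comm]
  exact mul_le_of_le_one_right hr.le (hc y hy)

theorem IsProperCSet.exists_norm_le {X : Set (EuclideanSpace ℝ ι)} (hX : IsProperCSet X) :
    ∃ R : ℝ, 0 < R ∧ ∀ y ∈ X, ‖y‖ ≤ R :=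
  hX.isCompact.isBounded.exists_pos_norm_le

theorem IsProperCSet.exists_ball_subset {X : Set (EuclideanSpace ℝ ι)} (hX : IsProperCSet X) :
    ∃ r : ℝ, 0 < r ∧ ∀ y, ‖y‖ ≤ r → y ∈ X := by
  obtain ⟨r, hr, h⟩ := Metric.nhds_basis_closedBall.mem_iff.1
    (mem_interior_iff_mem_nhds.1 hX.zero_mem_interior)
  exact ⟨r, hr, fun y hy => h (by simpa using hy)⟩

end Polar

/-! ### From dilation gaps to Hausdorff convergence -/

section Sandwich

variable {ι : Type*} [Fintype ι]

/-- A point (1 + d)y of the dilation is within d‖y‖ of y, and y belongs to both sets. -/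
theorem hausdorffDist_le_of_sandwich {K S S' : Set (EuclideanSpace ℝ ι)} {d R : ℝ} (hd : 0 ≤ d)
    (hR : 0 ≤ R) (hK : ∀ y ∈ K, ‖y‖ ≤ R) (hKS : K ⊆ S) (hS : S ⊆ (1 + d) • K) (hKS' : K ⊆ S')
    (hS' : S' ⊆ (1 + d) • K) : Metric.hausdorffDist S S' ≤ d * R := by
  have key : ∀ x ∈ (1 + d) • K, ∃ y ∈ K, dist x y ≤ d * R := by
    rintro _ ⟨y, hy, rfl⟩
    refine ⟨y, hy, ?_⟩
    have : (1 + d) • y - y = d • y := by rw [add_smul, one_smul]; abel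
    change dist ((1 + d) • y) y ≤ d * R
    rw [dist_eq_norm, this, norm_smul, Real.norm_of_nonneg hd]
    exact mul_le_mul_of_nonneg_left (hK y hy) hd
  refine Metric.hausdorffDist_le_of_mem_dist (by positivity) (fun x hx => ?_) fun x hx => ?_
  · obtain ⟨y, hy, h⟩ := key x (hS hx)
    exact ⟨y, hKS' hy, h⟩
  · obtain ⟨y, hy, h⟩ := key x (hS' hx)
    exact ⟨y, hKS hy, h⟩

theorem hausdorffTendsto_of_sandwich {K S : ℕ → Set (EuclideanSpace ℝ ι)}
    {Y : Set (EuclideanSpace ℝ ι)} {d : ℕ → ℝ} {R : ℝ} (hd : ∀ k, 0 ≤ d k)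
    (hd0 : Tendsto d atTop (𝓝 0)) (hR : 0 ≤ R) (hK : ∀ k, ∀ y ∈ K k, ‖y‖ ≤ R)
    (hKS : ∀ k, K k ⊆ S k) (hS : ∀ k, S k ⊆ (1 + d k) • K k)
    (hKY : ∀ k, K k ⊆ Y) (hY : ∀ k, Y ⊆ (1 + d k) • K k)
    (hSC : ∀ k, IsCSet (S k)) (hYC : IsCSet Y) : HausdorffTendsto S Y where
  terms k := ⟨⟨0, (hSC k).zero_mem⟩, (hSC k).isCompact, (hSC k).convex⟩
  limit := ⟨⟨0, hYC.zero_mem⟩, hYC.isCompact, hYC.convex⟩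
  tendsto := by
    refine squeeze_zero (fun _ => Metric.hausdorffDist_nonneg)
      (fun k => hausdorffDist_le_of_sandwich (hd k) hR (hK k) (hKS k) (hS k) (hKY k) (hY k)) ?_
    simpa using hd0.mul_const R

/-- A set contained in all dilations of a closed set by factors tending to one is contained in that
set. -/
theorem subset_of_subset_smul {X Y : Set (EuclideanSpace ℝ ι)} (hY : IsClosed Y) {d : ℕ → ℝ}
    (hd : ∀ k, 0 ≤ d k) (hd0 : Tendsto d atTop (𝓝 0)) (h : ∀ k, X ⊆ (1 + d k) • Y) : X ⊆ Y := by
  intro x hx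
  have hlim : Tendsto (fun k => (1 + d k)⁻¹ • x) atTop (𝓝 x) := by
    have : Tendsto (fun k => (1 + d k)⁻¹) atTop (𝓝 1) := by
      simpa using (hd0.const_add 1).inv₀ (by norm_num)
    simpa using this.smul_const x
  refine hY.mem_of_tendsto hlim (Eventually.of_forall fun k => ?_)
  exact (Set.mem_smul_set_iff_inv_smul_mem₀ (by linarith [hd k]) _ _).1 (h k hx)

end Sandwich

/-! ### The set map: monotonicity, bounds and contraction -/

section Step

variable {n m : ℕ} {A : Matrix (Fin n) (Fin n) ℝ} {B : Matrix (Fin n) (Fin m) ℝ}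
  {C : Set (EuclideanSpace ℝ (Fin n ⊕ Fin m))}

theorem matImage_mono {ι κ : Type*} [Fintype ι] [Fintype κ] [DecidableEq κ] (M : Matrix ι κ ℝ)
    {X Y : Set (EuclideanSpace ℝ κ)} (h : X ⊆ Y) : matImage M X ⊆ matImage M Y :=
  Set.image_mono h

theorem matImage_smul {ι κ : Type*} [Fintype ι] [Fintype κ] [DecidableEq κ] (M : Matrix ι κ ℝ)
    (a : ℝ) (X : Set (EuclideanSpace ℝ κ)) : matImage M (a • X) = a • matImage M X :=
  Set.image_smul_comm _ _ _ fun x => map_smul _ a x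

theorem IsCSet.matImage {ι κ : Type*} [Fintype ι] [Fintype κ] [DecidableEq κ] (M : Matrix ι κ ℝ)
    {X : Set (EuclideanSpace ℝ κ)} (h : IsCSet X) : IsCSet (matImage M X) where
  isCompact := h.isCompact.image (LinearMap.continuous_of_finiteDimensional _)
  convex := h.convex.linear_image (Matrix.toEuclideanLin M)
  zero_mem := ⟨0, h.zero_mem, map_zero _⟩

theorem mem_stepT {P : Set (EuclideanSpace ℝ (Fin n))} {z : EuclideanSpace ℝ (Fin n ⊕ Fin m)} :
    z ∈ stepT A B C P ↔ ∀ c ∈ polar C, ∀ p ∈ polar P,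
      inner ℝ c z + inner ℝ p (Matrix.toEuclideanLin (Matrix.fromCols A B) z) ≤ 1 := by
  have adj : ∀ p, inner ℝ (Matrix.toEuclideanLin (Matrix.fromCols A B).transpose p) z
      = inner ℝ p (Matrix.toEuclideanLin (Matrix.fromCols A B) z) := by
    intro p
    rw [← LinearMap.adjoint_inner_left, ← Matrix.toEuclideanLin_conjTranspose_eq_adjoint,
      Matrix.conjTranspose_eq_transpose_of_trivial]
  constructor
  · intro h c hc p hp
    have := h _ (Set.add_mem_add hc ⟨p, hp, rfl⟩)
    rwa [inner_add_left, adj] at this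
  · rintro h _ ⟨c, hc, _, ⟨p, hp, rfl⟩, rfl⟩
    change inner ℝ (c + _) z ≤ 1
    rw [inner_add_left, adj]
    exact h c hc p hp

theorem stepT_mono {P P' : Set (EuclideanSpace ℝ (Fin n))} (h : P ⊆ P') :
    stepT A B C P ⊆ stepT A B C P' := fun _ hz =>
  mem_stepT.2 fun c hc p hp => mem_stepT.1 hz c hc p (polar_anti h hp)

/-- Testing with p = 0 leaves the bipolar of C. The bound does not depend on P, so one step from the
whole space is already bounded. -/
theorem norm_le_of_mem_stepT {R : ℝ} (hR : 0 < R) (hC : ∀ y ∈ C, ‖y‖ ≤ R)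
    {P : Set (EuclideanSpace ℝ (Fin n))} {z : EuclideanSpace ℝ (Fin n ⊕ Fin m)}
    (hz : z ∈ stepT A B C P) : ‖z‖ ≤ R := by
  have hz' : z ∈ polar (polar C) := fun c hc => by
    simpa using mem_stepT.1 hz c hc 0 (zero_mem_polar _)
  have := norm_le_of_mem_polar (one_div_pos.2 hR) (fun y hy => mem_polar_of_norm_mul_le hC (by
    rwa [le_div_iff₀' hR] at hy)) hz'
  simpa using this

theorem isCSet_stepT (hC : IsProperCSet C) (P : Set (EuclideanSpace ℝ (Fin n))) :
    IsCSet (stepT A B C P) where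
  isCompact := by
    obtain ⟨R, hR, hCR⟩ := hC.exists_norm_le
    refine Metric.isCompact_of_isClosed_isBounded (isClosed_polar _)
      (isBounded_iff_forall_norm_le.2 ⟨R, fun z hz => norm_le_of_mem_stepT hR hCR hz⟩)
  convex := convex_polar _
  zero_mem := zero_mem_polar _

theorem isProperCSet_stepT (hC : IsProperCSet C) {P : Set (EuclideanSpace ℝ (Fin n))}
    (hP : IsProperCSet P) : IsProperCSet (stepT A B C P) where
  toIsCSet := isCSet_stepT hC P
  zero_mem_interior := by
    obtain ⟨r, hr, hCr⟩ := hC.exists_ball_subset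
    obtain ⟨s, hs, hPs⟩ := hP.exists_ball_subset
    have hcont : Continuous (Matrix.toEuclideanLin (Matrix.fromCols A B)) :=
      LinearMap.continuous_of_finiteDimensional _
    have hlim : Tendsto (fun z : EuclideanSpace ℝ (Fin n ⊕ Fin m) =>
        1 / r * ‖z‖ + 1 / s * ‖Matrix.toEuclideanLin (Matrix.fromCols A B) z‖) (𝓝 0) (𝓝 0) := by
      have : Continuous (fun z : EuclideanSpace ℝ (Fin n ⊕ Fin m) =>
        1 / r * ‖z‖ + 1 / s * ‖Matrix.toEuclideanLin (Matrix.fromCols A B) z‖) := by fun_prop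
      simpa using this.tendsto 0
    refine mem_interior_iff_mem_nhds.2 ?_
    filter_upwards [hlim.eventually (gt_mem_nhds one_pos)] with z hz
    refine mem_stepT.2 fun c hc p hp => le_trans (add_le_add ?_ ?_) hz.le
    · exact (real_inner_le_norm _ _).trans (by gcongr; exact norm_le_of_mem_polar hr hCr hc)
    · exact (real_inner_le_norm _ _).trans (by gcongr; exact norm_le_of_mem_polar hs hPs hp)

theorem inv_smul_mem_polar_of_subset_smul {ι : Type*} [Fintype ι]
    {X Y : Set (EuclideanSpace ℝ ι)} {a : ℝ} (ha : 0 < a) (h : Y ⊆ a • X)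
    {p : EuclideanSpace ℝ ι} (hp : p ∈ polar X) : a⁻¹ • p ∈ polar Y := by
  intro y hy
  have := hp _ ((Set.mem_smul_set_iff_inv_smul_mem₀ ha.ne' _ _).1 (h hy))
  rwa [real_inner_smul_left, ← real_inner_smul_right] at this

/-- Scaling by a⁻¹ sends `polar P` into `polar P'` and, since a ≥ 1, `polar C` into itself. -/
theorem stepT_subset_smul {P P' : Set (EuclideanSpace ℝ (Fin n))} {a : ℝ} (ha : 1 ≤ a)
    (h : P' ⊆ a • P) : stepT A B C P' ⊆ a • stepT A B C P := by
  intro z hz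
  have ha0 : 0 < a := by linarith
  refine (Set.mem_smul_set_iff_inv_smul_mem₀ ha0.ne' _ _).2 (mem_stepT.2 fun c hc p hp => ?_)
  have := mem_stepT.1 hz (a⁻¹ • c)
    ((convex_polar C).smul_mem_of_zero_mem (zero_mem_polar C) hc
      ⟨by positivity, inv_le_one_of_one_le₀ ha⟩) _ (inv_smul_mem_polar_of_subset_smul ha0 h hp)
  rw [map_smul, real_inner_smul_right, real_inner_smul_right]
  rwa [real_inner_smul_left, real_inner_smul_left] at this

theorem toEuclideanLin_projX_pair (x : EuclideanSpace ℝ (Fin n)) (u : EuclideanSpace ℝ (Fin m)) :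
    Matrix.toEuclideanLin (projX n m) (pair x u) = x := by
  ext i
  simp [projX, pair, Matrix.toLpLin_apply, Matrix.fromCols_mulVec]

theorem toEuclideanLin_fromCols_pair (x : EuclideanSpace ℝ (Fin n))
    (u : EuclideanSpace ℝ (Fin m)) :
    Matrix.toEuclideanLin (Matrix.fromCols A B) (pair x u)
      = Matrix.toEuclideanLin A x + Matrix.toEuclideanLin B u := by
  ext i
  simp [pair, Matrix.toLpLin_apply, Matrix.fromCols_mulVec]

theorem norm_toEuclideanLin_projX_le (z : EuclideanSpace ℝ (Fin n ⊕ Fin m)) :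
    ‖Matrix.toEuclideanLin (projX n m) z‖ ≤ ‖z‖ := by
  rw [EuclideanSpace.norm_eq, EuclideanSpace.norm_eq]
  refine Real.sqrt_le_sqrt ?_
  rw [Fintype.sum_sum_type]
  have : ∀ i, Matrix.toEuclideanLin (projX n m) z i = z (Sum.inl i) := fun i => by
    simp [projX, Matrix.toLpLin_apply, Matrix.fromCols_mulVec]
  simp only [this]
  exact le_add_of_nonneg_right (Finset.sum_nonneg fun _ _ => by positivity)

/-- The Bellman-type set map `P ↦ P_x (C^* ⊕ (A B)ᵀ P^*)^*`. -/
def stepP (A : Matrix (Fin n) (Fin n) ℝ) (B : Matrix (Fin n) (Fin m) ℝ)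
    (C : Set (EuclideanSpace ℝ (Fin n ⊕ Fin m))) (P : Set (EuclideanSpace ℝ (Fin n))) :
    Set (EuclideanSpace ℝ (Fin n)) :=
  matImage (projX n m) (stepT A B C P)

theorem stepP_mono {P P' : Set (EuclideanSpace ℝ (Fin n))} (h : P ⊆ P') :
    stepP A B C P ⊆ stepP A B C P' :=
  matImage_mono _ (stepT_mono h)

theorem isCSet_stepP (hC : IsProperCSet C) (P : Set (EuclideanSpace ℝ (Fin n))) :
    IsCSet (stepP A B C P) :=
  (isCSet_stepT hC P).matImage _

theorem norm_le_of_mem_stepP {R : ℝ} (hR : 0 < R) (hC : ∀ y ∈ C, ‖y‖ ≤ R)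
    {P : Set (EuclideanSpace ℝ (Fin n))} {x : EuclideanSpace ℝ (Fin n)}
    (hx : x ∈ stepP A B C P) : ‖x‖ ≤ R := by
  obtain ⟨z, hz, rfl⟩ := hx
  exact (norm_toEuclideanLin_projX_le z).trans (norm_le_of_mem_stepT hR hC hz)

/-- For x in L, the control u from the Lyapunov inequality makes (x, u) a lift of x: the two gauges
bound the two inner products, and their sum is at most g_L(x) ≤ 1. -/
theorem ControlLyapunov.subset_stepP {L : Set (EuclideanSpace ℝ (Fin n))}
    (hC : IsProperCSet C) (hL : IsProperCSet L) (h : ControlLyapunov A B C L) :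
    L ⊆ stepP A B C L := by
  intro x hx
  obtain ⟨u, hu⟩ := h x
  refine ⟨pair x u, mem_stepT.2 fun c hc p hp => ?_, toEuclideanLin_projX_pair x u⟩
  have h1 := inner_le_gauge (mem_interior_iff_mem_nhds.1 hC.zero_mem_interior) hc (pair x u)
  have h2 := inner_le_gauge (mem_interior_iff_mem_nhds.1 hL.zero_mem_interior) hp
    (Matrix.toEuclideanLin (Matrix.fromCols A B) (pair x u))
  rw [toEuclideanLin_fromCols_pair] at h2 ⊢
  have h3 := gauge_le_one_of_mem hx
  linarith

/-- The set map `stepP` contracts the relative gap between two sets, provided that the image of the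
smaller one contains a fixed ball. -/
theorem stepP_subset_smul_of_subset_smul {R r : ℝ} (hR : 0 < R) (hr : 0 < r)
    (hC : ∀ y ∈ C, ‖y‖ ≤ R) (hrR : r ≤ R) {P P' : Set (EuclideanSpace ℝ (Fin n))}
    (hP : ∀ y, ‖y‖ ≤ r → y ∈ stepP A B C P) (hPC : IsCSet (stepP A B C P)) {d : ℝ}
    (hd : 0 ≤ d) (h : P' ⊆ (1 + d) • P) :
    stepP A B C P' ⊆ (1 + (1 - r / R) * d) • stepP A B C P := by
  rintro _ ⟨z, hz, rfl⟩
  have hε : 0 ≤ 1 - r / R := sub_nonneg.2 ((div_le_one hR).2 hrR)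
  have h1d : 1 ≤ 1 + (1 - r / R) * d := le_add_of_nonneg_right (by positivity)
  -- A short z projects into the ball that the target already contains; the polar estimate needs ‖z‖
  -- > r.
  by_cases hs : ‖z‖ ≤ r
  · exact subset_smul_of_one_le hPC.convex hPC.zero_mem h1d
      (hP _ ((norm_toEuclideanLin_projX_le z).trans hs))
  push Not at hs
  have hz0 : 0 < ‖z‖ := hr.trans hs
  -- The vector of norm 1/R along z lies in the polar of C and spends ‖z‖/R ≥ r/R of the budget 1.
  have hc : (1 / (R * ‖z‖)) • z ∈ polar C := mem_polar_of_norm_mul_le hC (by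
    rw [norm_smul, Real.norm_of_nonneg (by positivity)]
    apply le_of_eq; field_simp)
  have hcz : r / R ≤ inner ℝ ((1 / (R * ‖z‖)) • z) z := by
    rw [real_inner_smul_left, real_inner_self_eq_norm_sq]
    have : 1 / (R * ‖z‖) * ‖z‖ ^ 2 = ‖z‖ / R := by field_simp
    rw [this]
    gcongr
  unfold stepP
  rw [← matImage_smul]
  refine ⟨z, (Set.mem_smul_set_iff_inv_smul_mem₀ (by linarith) _ _).2
    (mem_stepT.2 fun c hc' p hp => ?_), rfl⟩
  have h1d' : 0 < 1 + d := by linarith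
  have hp' := inv_smul_mem_polar_of_subset_smul h1d' h hp
  have e1 := mem_stepT.1 hz _ hc _ hp'
  have e2 := mem_stepT.1 hz _ hc' _ hp'
  rw [real_inner_smul_left p] at e1 e2
  set t := inner ℝ p (Matrix.toEuclideanLin (Matrix.fromCols A B) z)
  -- With s = t/(1 + d), `e1` gives s ≤ 1 - r/R and `e2` gives ⟨c, z⟩ + s ≤ 1; then t = s + ds
  -- yields the factor.
  have ht : t = (1 + d) * ((1 + d)⁻¹ * t) := by field_simp
  have e3 : d * ((1 + d)⁻¹ * t) ≤ d * (1 - r / R) :=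
    mul_le_mul_of_nonneg_left (by linarith) hd
  rw [map_smul, real_inner_smul_right, real_inner_smul_right, ← mul_add,
    inv_mul_le_iff₀ (by linarith)]
  linarith

end Step

end MinkowskiBellman

/-! ### Convergence of the iterates and the fixed point -/

theorem theorem5p2 (n m : ℕ)
    (A : Matrix (Fin n) (Fin n) ℝ) (B : Matrix (Fin n) (Fin m) ℝ)
    (C : Set (EuclideanSpace ℝ (Fin n ⊕ Fin m)))
    (Qf L : Set (EuclideanSpace ℝ (Fin n)))
    (hAB : StrictlyStabilizable A B)
    (hC : IsProperCSet C)
    (hQf : IsProperCSet Qf)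
    (hL : IsProperCSet L)
    (hLyap : ControlLyapunov A B C L)
    (hLQ : L ⊆ Qf) :
    ∃ (Pinf Plow Pup : Set (EuclideanSpace ℝ (Fin n)))
      (Tinf : Set (EuclideanSpace ℝ (Fin n ⊕ Fin m))),
      -- convergence of the arbitrary iterates `P_{k+1}`, started at `P_0 = Q_f`
      (IsProperCSet Pinf ∧ HausdorffTendsto (fun k => genP A B C Qf (k + 1)) Pinf) ∧
      -- the lower iterates (`P_0^* = {0}`) and the upper iterates (`P_0 = L`) have the same limit
      (HausdorffTendsto (fun k => genP A B C Set.univ (k + 1)) Plow ∧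
        HausdorffTendsto (fun k => genP A B C L (k + 1)) Pup ∧
        Pup = Pinf ∧ Pinf = Plow) ∧
      -- convergence of the sets `T_{k+1}`
      (IsProperCSet Tinf ∧
        HausdorffTendsto (fun k => stepT A B C (genP A B C Qf k)) Tinf ∧
        Tinf = stepT A B C Pinf ∧ Pinf = matImage (projX n m) Tinf) ∧
      -- the fixed point set equation
      Pinf = matImage (projX n m) (stepT A B C Pinf) := by
  obtain ⟨R₀, hR₀, hCR₀⟩ := hC.exists_norm_le
  obtain ⟨r, hr, hLr⟩ := hL.exists_ball_subset
  set R := max R₀ r with hRdef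
  have hR : 0 < R := lt_max_of_lt_right hr
  have hCR : ∀ y ∈ C, ‖y‖ ≤ R := fun y hy => (hCR₀ y hy).trans (le_max_left _ _)
  have hrR : r ≤ R := le_max_right _ _
  have hLF := hLyap.subset_stepP hC hL
  have hmono : ∀ {P P' : Set (EuclideanSpace ℝ (Fin n))}, P ⊆ P' → ∀ k,
      genP A B C P k ⊆ genP A B C P' k := by
    intro P P' h k
    induction k with
    | zero => exact h
    | succ k ih => exact stepP_mono ih
  have hup : Monotone (genP A B C L) := monotone_nat_of_le_succ fun k => by
    induction k with
    | zero => exact hLF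
    | succ k ih => exact stepP_mono ih
  have hlow : Antitone (genP A B C Set.univ) := antitone_nat_of_succ_le fun k => by
    induction k with
    | zero => exact Set.subset_univ _
    | succ k ih => exact stepP_mono ih
  have hLup : ∀ k, L ⊆ genP A B C L k := fun k => hup (Nat.zero_le k)
  have hCS : ∀ P k, IsCSet (genP A B C P (k + 1)) := fun P k => isCSet_stepP hC _
  set q := 1 - r / R with hq
  have hq0 : 0 ≤ q := sub_nonneg.2 ((div_le_one hR).2 hrR)
  have hq1 : q < 1 := sub_lt_self _ (by positivity)
  -- R/r - 1 is the initial gap: the first lower iterate lies in the ball of radius R, which is R/r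
  -- times a ball inside L.
  set d : ℕ → ℝ := fun k => q ^ k * (R / r - 1) with hd
  have hd1 : 0 ≤ R / r - 1 := sub_nonneg.2 ((one_le_div hr).2 hrR)
  have hdn : ∀ k, 0 ≤ d k := fun k => by positivity
  have hd0 : Tendsto d atTop (𝓝 0) := by
    simpa using (tendsto_pow_atTop_nhds_zero_of_lt_one hq0 hq1).mul_const (R / r - 1)
  have hgap : ∀ k, genP A B C Set.univ (k + 1) ⊆ (1 + d k) • genP A B C L (k + 1) := by
    intro k
    induction k with
    | zero =>
      intro x hx
      have hx' := norm_le_of_mem_stepP hR hCR hx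
      have : 1 + d 0 = R / r := by simp [hd]
      rw [this, Set.mem_smul_set_iff_inv_smul_mem₀ (by positivity)]
      refine hLup 1 (hLr _ ?_)
      rw [norm_smul, Real.norm_of_nonneg (by positivity), inv_div, div_mul_eq_mul_div,
        div_le_iff₀ hR]
      gcongr
    | succ k ih =>
      have := stepP_subset_smul_of_subset_smul hR hr hCR hrR
        (fun y hy => hLup (k + 2) (hLr y hy)) (hCS L (k + 1)) (hdn k) ih
      have e : d (k + 1) = (1 - r / R) * d k := by simp only [hd, pow_succ, hq]; ring
      rw [e]
      exact this
  set Pinf := ⋂ k, genP A B C Set.univ (k + 1) with hPinf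
  have hupP : ∀ k, genP A B C L k ⊆ Pinf := fun k => Set.subset_iInter fun j => by
    calc genP A B C L k ⊆ genP A B C L (max k (j + 1)) := hup (le_max_left _ _)
      _ ⊆ genP A B C Set.univ (max k (j + 1)) := hmono (Set.subset_univ _) _
      _ ⊆ genP A B C Set.univ (j + 1) := hlow (le_max_right _ _)
  have hPlow : ∀ k, Pinf ⊆ genP A B C Set.univ (k + 1) := fun k => Set.iInter_subset _ k
  have hPC : IsProperCSet Pinf :=
    { isCompact := (hCS Set.univ 0).isCompact.of_isClosed_subset
        (isClosed_iInter fun k => (hCS Set.univ k).isCompact.isClosed) (hPlow 0)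
      convex := convex_iInter fun k => (hCS Set.univ k).convex
      zero_mem := hupP 0 hL.zero_mem
      zero_mem_interior := interior_mono (hupP 0) hL.zero_mem_interior }
  have hPgap : ∀ k, Pinf ⊆ (1 + d k) • genP A B C L (k + 1) :=
    fun k => (hPlow k).trans (hgap k)
  have hbd : ∀ k, ∀ y ∈ genP A B C L (k + 1), ‖y‖ ≤ R :=
    fun k y hy => norm_le_of_mem_stepP hR hCR hy
  have hconv : ∀ P, L ⊆ P → HausdorffTendsto (fun k => genP A B C P (k + 1)) Pinf :=
    fun P hP => hausdorffTendsto_of_sandwich hdn hd0 hR.le hbd (fun k => hmono hP _)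
      (fun k => (hmono (Set.subset_univ P) _).trans (hgap k)) (fun k => hupP _) hPgap
      (hCS P) hPC.toIsCSet
  have hfix : Pinf = matImage (projX n m) (stepT A B C Pinf) := by
    refine Set.Subset.antisymm ?_ (Set.subset_iInter fun k => ?_)
    -- F(`Pinf`) contains every upper iterate, so its dilations by 1 + d k contain `Pinf`;
    -- closedness removes the factor.
    · refine subset_of_subset_smul (isCSet_stepP hC Pinf).isCompact.isClosed hdn hd0 fun k => ?_
      exact (hPgap k).trans (Set.smul_set_mono (stepP_mono (hupP k)))
    · cases k with
      | zero => exact stepP_mono (Set.subset_univ _)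
      | succ k => exact stepP_mono (hPlow k)
  have hTtail : HausdorffTendsto (fun k => stepT A B C (genP A B C Qf (k + 1)))
      (stepT A B C Pinf) :=
    hausdorffTendsto_of_sandwich (K := fun k => stepT A B C (genP A B C L (k + 1))) hdn hd0 hR.le
      (fun k y hy => norm_le_of_mem_stepT hR hCR hy) (fun k => stepT_mono (hmono hLQ _))
      (fun k => stepT_subset_smul (le_add_of_nonneg_right (hdn k))
        ((hmono (Set.subset_univ Qf) _).trans (hgap k)))
      (fun k => stepT_mono (hupP _))
      (fun k => stepT_subset_smul (le_add_of_nonneg_right (hdn k)) (hPgap k))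
      (fun k => isCSet_stepT hC _) (isCSet_stepT hC _)
  -- The gap estimate starts at index 1, so the term built from Qf itself is added by shifting the
  -- limit.
  have hT : HausdorffTendsto (fun k => stepT A B C (genP A B C Qf k)) (stepT A B C Pinf) :=
    { terms := fun k => ⟨⟨0, zero_mem_polar _⟩, (isCSet_stepT hC _).isCompact, convex_polar _⟩
      limit := hTtail.limit
      tendsto := (tendsto_add_atTop_iff_nat 1).1 hTtail.tendsto }
  exact ⟨Pinf, Pinf, Pinf, stepT A B C Pinf, ⟨hPC, hconv Qf hLQ⟩,
    ⟨hconv _ (Set.subset_univ L), hconv L subset_rfl, rfl, rfl⟩,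
    ⟨isProperCSet_stepT hC hPC, hT, rfl, hfix⟩, hfix⟩
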